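/- Let $\mathbb{O}$ be the octonions and $\mathbb{O}'$ the split octonions, the latter with basis $1,I,J,K,KL,JL,IL,L$, where $I^2=J^2=K^2=-1$, $IJ=K$, $L^2=1$. Put $L_\pm=\frac12(1\pm L)$ and let $\mathcal N_\pm=\{IL_\pm,JL_\pm,KL_\pm\}$, sets of null split octonions. Let $\mathrm{H}_3(\mathbb{O})$ be the Albert algebra of $3\times3$ Hermitian octonionic matrices, with identity $\mathcal I$, Jordan product $\mathcal X\circ\mathcal Y=\frac12(\mathcal X\mathcal Y+\mathcal Y\mathcal X)$ and Freudenthal product $$\mathcal X*\mathcal Y=\mathcal X\circ\mathcal Y-\tfrac12\bigl((\mathrm{tr}\,\mathcal X)\,\mathcal Y+(\mathrm{tr}\,\mathcal Y)\,\mathcal X\bigr)+\tfrac12\bigl((\mathrm{tr}\,\mathcal X)(\mathrm{tr}\,\mathcal Y)-\mathrm{tr}(\mathcal X\circ\mathcal Y)\bigr)\,\mathcal I .$$ Realize $\mathfrak e_8=\mathfrak e_{8(-24)}$ as the space of tracefree anti-Hermitian $3\times3$ matrices over $\mathbb{O}'\otimes\mathbb{O}$, plus $\mathfrak{der}(\mathbb{O}')\oplus\mathfrak{der}(\mathbb{O})$.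 Derivations act on matrices entrywise and on each other by commutators. The bracket of two matrices $A=(a_{ij})$, $B=(b_{ij})$ is the tracefree part $AB-BA-\frac13\mathrm{tr}(AB-BA)\,\mathcal I$ of their commutator plus the derivation $\frac13\sum_{i,j}D(a_{ij},b_{ji})$, where $D(p\otimes x,q\otimes y)=\mathrm{Re}(xy)\,D_{p,q}+\mathrm{Re}(pq)\,D_{x,y}$ and $D_{x,y}z=[[x,y],z]-3\bigl((xy)z-x(yz)\bigr)$. For $p\in\mathbb{O}'\otimes\mathbb{O}$ let $$X_p=\begin{pmatrix}0&p&0\\-\bar p&0&0\\0&0&0\end{pmatrix},\quad Y_p=\begin{pmatrix}0&0&0\\0&0&p\\0&-\bar p&0\end{pmatrix},\quad Z_p=\begin{pmatrix}0&0&-\bar p\\0&0&0\\p&0&0\end{pmatrix},$$ where the bar conjugates both factors. For anticommuting $p,q\in\mathrm{Im}\,\mathbb{O}'$ let $(p\circ q)\,\mathcal I=\frac14\bigl([X_p,X_q]+[Y_p,Y_q]+[Z_p,Z_q]\bigr)\in\mathfrak e_8$, and for $Q\in\mathrm{Im}\,\mathbb{O}'$ orthogonal to $L$ let $G_Q=-2\,(QL\circ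 L)\,\mathcal I$. For such $Q$ and $\mathcal X\in\mathrm{H}_3(\mathbb{O})$, with tracefree part $\mathcal X_0=\mathcal X-\frac13(\mathrm{tr}\,\mathcal X)\,\mathcal I$, let $$Q\mathcal X=Q\mathcal X_0+\tfrac13(\mathrm{tr}\,\mathcal X)\bigl(-\tfrac12G_Q\bigr)\in\mathfrak e_8,$$ where $Q\mathcal X_0$ is the matrix with entries $Q\otimes(\mathcal X_0)_{ij}$; that is, "$Q\,\mathcal I$" is interpreted as $(QL\circ L)\,\mathcal I=-\frac12G_Q$. **Lemma.** Let $Q_1\ne Q_2$ be both in $\mathcal N_+$ or both in $\mathcal N_-$, and let $\mathcal X,\mathcal Y\in\mathrm{H}_3(\mathbb{O})$. Then $Q_1Q_2$ is imaginary and orthogonal to $L$, and in $\mathfrak e_8$ $$[Q_1\mathcal X,Q_2\mathcal Y]=2\,(Q_1Q_2)(\mathcal X*\mathcal Y).$$ -/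

import Mathlib

open scoped TensorProduct Quaternion Matrix

noncomputable section

/-! ## Octonions and split octonions -/

/-- The Cayley-Dickson double of the real quaternions with parameter `γ`. The pair `⟨a, b⟩` stands
for `a + b ℓ`, where `ℓ = ⟨0, 1⟩` satisfies `ℓ ^ 2 = γ`. -/
@[ext]
structure Oct (γ : ℝ) where
  /-- The quaternion `a` in `a + b ℓ`. -/
  fst : ℍ[ℝ]
  /-- The quaternion `b` in `a + b ℓ`. -/
  snd : ℍ[ℝ]

namespace Oct

variable {γ : ℝ}

instance : Zero (Oct γ) := ⟨⟨0, 0⟩⟩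
instance : One (Oct γ) := ⟨⟨1, 0⟩⟩
instance : Add (Oct γ) := ⟨fun x y => ⟨x.fst + y.fst, x.snd + y.snd⟩⟩
instance : Neg (Oct γ) := ⟨fun x => ⟨-x.fst, -x.snd⟩⟩
instance : Sub (Oct γ) := ⟨fun x y => ⟨x.fst - y.fst, x.snd - y.snd⟩⟩
instance : SMul ℝ (Oct γ) := ⟨fun r x => ⟨r • x.fst, r • x.snd⟩⟩

/-- `(a + b ℓ) (c + d ℓ) = (a c + γ d̄ b) + (d a + b c̄) ℓ`. -/
instance : Mul (Oct γ) :=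
  ⟨fun x y => ⟨x.fst * y.fst + γ • (star y.snd * x.snd), y.snd * x.fst + x.snd * star y.fst⟩⟩

/-- Conjugation: `a + b ℓ ↦ ā - b ℓ`. -/
instance : Star (Oct γ) := ⟨fun x => ⟨star x.fst, -x.snd⟩⟩

@[simp] theorem add_fst (x y : Oct γ) : (x + y).fst = x.fst + y.fst := rfl
@[simp] theorem add_snd (x y : Oct γ) : (x + y).snd = x.snd + y.snd := rfl
@[simp] theorem sub_fst (x y : Oct γ) : (x - y).fst = x.fst - y.fst := rfl
@[simp] theorem sub_snd (x y : Oct γ) : (x - y).snd = x.snd - y.snd := rfl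
@[simp] theorem neg_fst (x : Oct γ) : (-x).fst = -x.fst := rfl
@[simp] theorem neg_snd (x : Oct γ) : (-x).snd = -x.snd := rfl
@[simp] theorem zero_fst : (0 : Oct γ).fst = 0 := rfl
@[simp] theorem zero_snd : (0 : Oct γ).snd = 0 := rfl
@[simp] theorem one_fst : (1 : Oct γ).fst = 1 := rfl
@[simp] theorem one_snd : (1 : Oct γ).snd = 0 := rfl
@[simp] theorem smul_fst (r : ℝ) (x : Oct γ) : (r • x).fst = r • x.fst := rfl
@[simp] theorem smul_snd (r : ℝ) (x : Oct γ) : (r • x).snd = r • x.snd := rfl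
@[simp] theorem mul_fst (x y : Oct γ) :
    (x * y).fst = x.fst * y.fst + γ • (star y.snd * x.snd) := rfl
@[simp] theorem mul_snd (x y : Oct γ) :
    (x * y).snd = y.snd * x.fst + x.snd * star y.fst := rfl
@[simp] theorem star_fst (x : Oct γ) : (star x).fst = star x.fst := rfl
@[simp] theorem star_snd (x : Oct γ) : (star x).snd = -x.snd := rfl

instance : AddCommGroup (Oct γ) where
  add_assoc x y z := by apply Oct.ext <;> simp [add_assoc]
  zero_add x := by apply Oct.ext <;> simp
  add_zero x := by apply Oct.ext <;> simp
  add_comm x y := by apply Oct.ext <;> simp [add_comm]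
  neg_add_cancel x := by apply Oct.ext <;> simp
  sub_eq_add_neg x y := by apply Oct.ext <;> simp [sub_eq_add_neg]
  nsmul := nsmulRec
  zsmul := zsmulRec

instance : Module ℝ (Oct γ) where
  one_smul x := by apply Oct.ext <;> simp
  mul_smul r s x := by apply Oct.ext <;> simp [mul_smul]
  smul_zero r := by apply Oct.ext <;> simp
  smul_add r x y := by apply Oct.ext <;> simp
  add_smul r s x := by apply Oct.ext <;> simp [add_smul]
  zero_smul x := by apply Oct.ext <;> simp

instance : NonAssocRing (Oct γ) where
  left_distrib x y z := by apply Oct.ext <;> simp [mul_add, add_mul] <;> abel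
  right_distrib x y z := by apply Oct.ext <;> simp [mul_add, add_mul] <;> abel
  zero_mul x := by apply Oct.ext <;> simp
  mul_zero x := by apply Oct.ext <;> simp
  one_mul x := by apply Oct.ext <;> simp
  mul_one x := by apply Oct.ext <;> simp

instance : IsScalarTower ℝ (Oct γ) (Oct γ) where
  smul_assoc r x y := by
    apply Oct.ext <;> simp [smul_smul, mul_comm]

instance : SMulCommClass ℝ (Oct γ) (Oct γ) where
  smul_comm r x y := by
    apply Oct.ext <;> simp [smul_smul, mul_comm]

instance : StarRing (Oct γ) where
  star_involutive x := by apply Oct.ext <;> simp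
  star_mul x y := by apply Oct.ext <;> simp
  star_add x y := by apply Oct.ext <;> simp [add_comm]

instance : StarModule ℝ (Oct γ) where
  star_smul r x := by apply Oct.ext <;> simp

/-- The real part, as a linear functional. -/
def re : Oct γ →ₗ[ℝ] ℝ where
  toFun x := x.fst.re
  map_add' _ _ := by simp
  map_smul' _ _ := by simp

theorem re_apply (x : Oct γ) : re x = x.fst.re := rfl

/-- The bilinear form `(x, y) ↦ Re (x y)`. -/
def reMul : Oct γ →ₗ[ℝ] Oct γ →ₗ[ℝ] ℝ := (LinearMap.mul ℝ (Oct γ)).compr₂ re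

variable (γ) in
/-- The derivations of the algebra `Oct γ`, as a subspace of its linear endomorphisms. -/
def der : Submodule ℝ (Module.End ℝ (Oct γ)) where
  carrier := {D | ∀ x y, D (x * y) = D x * y + x * D y}
  add_mem' {D D'} h h' x y := by
    simp only [LinearMap.add_apply, h x y, h' x y, add_mul, mul_add]; abel
  zero_mem' x y := by simp
  smul_mem' r D h x y := by simp [h x y, smul_mul_assoc, mul_smul_comm]

instance : AddCommGroup (der γ) := Submodule.addCommGroup _

instance : Module ℝ (der γ) := Submodule.module _

instance : MulAction ℝ (der γ) := Module.toDistribMulAction.toMulAction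

theorem commutator_mem_der {D D' : Module.End ℝ (Oct γ)} (h : D ∈ der γ) (h' : D' ∈ der γ) :
    D * D' - D' * D ∈ der γ := by
  change ∀ x y, _ at h
  change ∀ x y, _ at h'
  intro x y
  simp only [LinearMap.sub_apply, Module.End.mul_apply, h, h', map_add, sub_mul, mul_sub]
  abel

/-- The endomorphism `z ↦ [[x, y], z] - 3 ((x y) z - x (y z))`. -/
def innerEnd (x y : Oct γ) : Module.End ℝ (Oct γ) :=
  LinearMap.mulLeft ℝ (x * y - y * x) - LinearMap.mulRight ℝ (x * y - y * x)
    - (3 : ℝ) • (LinearMap.mulLeft ℝ (x * y) - LinearMap.mulLeft ℝ x * LinearMap.mulLeft ℝ y)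

theorem innerEnd_apply (x y z : Oct γ) : innerEnd x y z =
    (x * y - y * x) * z - z * (x * y - y * x) - (3 : ℝ) • ((x * y) * z - x * (y * z)) := by
  simp [innerEnd]

theorem associator_self_left (x y : Oct γ) : (x * x) * y = x * (x * y) := by
  apply Oct.ext <;> ext <;> simp <;> ring

theorem associator_self_right (x y : Oct γ) : (y * x) * x = y * (x * x) := by
  apply Oct.ext <;> ext <;> simp <;> ring

theorem associator_swap_left (x y z : Oct γ) : associator y x z = -associator x y z := by
  have h := associator_self_left (x + y) z
  simp only [add_mul, mul_add, associator_self_left] at h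
  simp only [associator]
  linear_combination (norm := module) h

theorem associator_swap_right (x y z : Oct γ) : associator x z y = -associator x y z := by
  have h := associator_self_right (y + z) x
  simp only [add_mul, mul_add, associator_self_right] at h
  simp only [associator]
  linear_combination (norm := module) h

theorem associator_pentagon (x y z w : Oct γ) :
    associator (x * y) z w - associator x (y * z) w + associator x y (z * w)
      - x * associator y z w - associator x y z * w = 0 := by
  simp only [associator, mul_sub, sub_mul]
  abel

theorem associator_product (x y z w : Oct γ) :
    associator (x * y) z w - associator (y * x) z w + associator x y (z * w)
      - associator x y z * w - z * associator x y w = 0 := by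
  have l := @associator_swap_left γ
  have r := @associator_swap_right γ
  have p201 (x y z : Oct γ) : associator z x y = associator x y z := by rw [l x z y, r x y z, neg_neg]
  have p210 (x y z : Oct γ) : associator z y x = -associator x y z := by rw [r z x y, l x z y, r x y z, neg_neg]
  have p021 (x y z : Oct γ) : associator x z y = -associator x y z := r x y z
  have p120 (x y z : Oct γ) : associator y z x = associator x y z := by rw [r y x z, l x y z, neg_neg]
  have p102 (x y z : Oct γ) : associator y x z = -associator x y z := l x y z
  have e1 := associator_pentagon x y z w
  have e2 := associator_pentagon x y w z
  have e3 := associator_pentagon x z y w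
  have e4 := associator_pentagon x z w y
  have e5 := associator_pentagon x w y z
  have e6 := associator_pentagon x w z y
  have e7 := associator_pentagon y x z w
  have e8 := associator_pentagon y z x w
  have e9 := associator_pentagon z x y w
  simp only [
    p201 y z w, p201 x y z, p210 y z w, p210 (z * w) x y, p210 (y * w) x z, p021 x y w,
    p021 x z w, p021 x y z, p021 (x * w) y z, p021 (x * y) z w, p021 (x * z) y w, p021 y z w,
    p120 (y * z) x w, p120 (z * y) x w, p120 (w * z) x y, p120 (z * w) x y, p120 (w * y) x z,
    p120 (y * w) x z, p120 x y z, p120 (x * w) y z, p120 y z w, p102 (w * y) x z,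
    p102 (w * z) x y, p102 (y * w) x z, p102 (y * z) x w, p102 (z * w) x y, p102 (z * y) x w,
    p102 x y z, p102 (x * z) y w, p102 (z * x) y w, p102 x z w, p102 (x * y) z w, p102 y z w,
    mul_neg, neg_mul] at e1 e2 e3 e4 e5 e6 e7 e8 e9 ⊢
  linear_combination (norm := module) (1 / 2 : ℝ) • e1 +
    (1 / 2 : ℝ) • e2 +
    (1 / 2 : ℝ) • e3 +
    (-1 / 2 : ℝ) • e4 +
    (1 / 2 : ℝ) • e5 +
    (-1 / 2 : ℝ) • e6 +
    (-1 : ℝ) • e7 +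
    (-1 : ℝ) • e8 +
    (1 : ℝ) • e9

theorem innerEnd_mem_der (x y : Oct γ) : innerEnd x y ∈ der γ := by
  intro z w
  have h := associator_product x y z w
  have h1 := associator_swap_left (x * y - y * x) z w
  have h2 := associator_swap_right z (x * y - y * x) w
  rw [h1, neg_neg] at h2
  simp only [innerEnd_apply]
  simp only [associator, sub_mul, mul_sub, smul_mul_assoc, mul_smul_comm] at h h1 h2 ⊢
  linear_combination (norm := module) (-3 : ℝ) • h + h1 - h2


theorem innerEnd_add_left (x x' y : Oct γ) :
    innerEnd (x + x') y = innerEnd x y + innerEnd x' y := by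
  ext1 z
  simp only [innerEnd_apply, LinearMap.add_apply, add_mul, mul_add, sub_mul, mul_sub]
  module

theorem innerEnd_add_right (x y y' : Oct γ) :
    innerEnd x (y + y') = innerEnd x y + innerEnd x y' := by
  ext1 z
  simp only [innerEnd_apply, LinearMap.add_apply, add_mul, mul_add, sub_mul, mul_sub]
  module

theorem innerEnd_smul_left (r : ℝ) (x y : Oct γ) : innerEnd (r • x) y = r • innerEnd x y := by
  ext1 z
  simp only [innerEnd_apply, LinearMap.smul_apply, sub_mul, mul_sub, smul_mul_assoc,
    mul_smul_comm]
  module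

theorem innerEnd_smul_right (r : ℝ) (x y : Oct γ) : innerEnd x (r • y) = r • innerEnd x y := by
  ext1 z
  simp only [innerEnd_apply, LinearMap.smul_apply, sub_mul, mul_sub, smul_mul_assoc,
    mul_smul_comm]
  module

/-- The derivation `D_{x,y} : z ↦ [[x, y], z] - 3 ((x y) z - x (y z))`, bilinear in `x`, `y`. -/
def innerDer : Oct γ →ₗ[ℝ] Oct γ →ₗ[ℝ] der γ :=
  LinearMap.mk₂ ℝ (fun x y => ⟨innerEnd x y, innerEnd_mem_der x y⟩)
    (fun x x' y => Subtype.ext (innerEnd_add_left x x' y))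
    (fun r x y => Subtype.ext (innerEnd_smul_left r x y))
    (fun x y y' => Subtype.ext (innerEnd_add_right x y y'))
    (fun r x y => Subtype.ext (innerEnd_smul_right r x y))

theorem der_one {D : Module.End ℝ (Oct γ)} (h : D ∈ der γ) : D 1 = 0 := by
  have := h 1 1
  simpa using this

theorem add_star_eq (x : Oct γ) : x + star x = (2 * re x) • (1 : Oct γ) := by
  apply Oct.ext <;> ext <;> simp [re_apply]
  ring

theorem mul_self_eq (x : Oct γ) :
    x * x = (2 * re x) • x - (re (star x * x)) • (1 : Oct γ) := by
  apply Oct.ext <;> ext <;> simp [re_apply] <;> ring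

/-- Derivations take imaginary values. -/
theorem re_der {D : Module.End ℝ (Oct γ)} (h : D ∈ der γ) (x : Oct γ) : re (D x) = 0 := by
  have e := h x x
  rw [mul_self_eq, map_sub, map_smul, map_smul, der_one h, smul_zero, sub_zero] at e
  by_contra hne
  have hx : x = (re x) • (1 : Oct γ) := by
    apply Oct.ext <;> ext
    · simp [re_apply]
    · have := congrArg (fun t => t.fst.imI) e
      simp [re_apply] at this hne ⊢
      have h' : (D x).fst.re * x.fst.imI = 0 := by linarith
      exact (mul_eq_zero.mp h').resolve_left hne
    · have := congrArg (fun t => t.fst.imJ) e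
      simp [re_apply] at this hne ⊢
      have h' : (D x).fst.re * x.fst.imJ = 0 := by linarith
      exact (mul_eq_zero.mp h').resolve_left hne
    · have := congrArg (fun t => t.fst.imK) e
      simp [re_apply] at this hne ⊢
      have h' : (D x).fst.re * x.fst.imK = 0 := by linarith
      exact (mul_eq_zero.mp h').resolve_left hne
    · have := congrArg (fun t => t.snd.re) e
      simp [re_apply] at this hne ⊢
      have h' : (D x).fst.re * x.snd.re = 0 := by linarith
      exact (mul_eq_zero.mp h').resolve_left hne
    · have := congrArg (fun t => t.snd.imI) e
      simp [re_apply] at this hne ⊢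
      have h' : (D x).fst.re * x.snd.imI = 0 := by linarith
      exact (mul_eq_zero.mp h').resolve_left hne
    · have := congrArg (fun t => t.snd.imJ) e
      simp [re_apply] at this hne ⊢
      have h' : (D x).fst.re * x.snd.imJ = 0 := by linarith
      exact (mul_eq_zero.mp h').resolve_left hne
    · have := congrArg (fun t => t.snd.imK) e
      simp [re_apply] at this hne ⊢
      have h' : (D x).fst.re * x.snd.imK = 0 := by linarith
      exact (mul_eq_zero.mp h').resolve_left hne
  apply hne
  rw [hx, map_smul, der_one h]
  simp

theorem der_star {D : Module.End ℝ (Oct γ)} (h : D ∈ der γ) (x : Oct γ) :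
    D (star x) = star (D x) := by
  have e1 : star x = (2 * re x) • (1 : Oct γ) - x := by rw [← add_star_eq]; abel
  have e2 : star (D x) = (2 * re (D x)) • (1 : Oct γ) - D x := by rw [← add_star_eq]; abel
  rw [e1, e2, re_der h, map_sub, map_smul, der_one h]
  simp

theorem eq_re_smul_one {x : Oct γ} (h : star x = x) : x = re x • (1 : Oct γ) := by
  have e := add_star_eq x
  rw [h, ← two_smul ℝ x, mul_smul] at e
  exact smul_right_injective (Oct γ) (two_ne_zero' ℝ) e

end Oct

/-- The octonions: `ℓ ^ 2 = -1`, with basis `1, i, j, k, kℓ, jℓ, iℓ, ℓ`. -/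
abbrev Octonion : Type := Oct (-1)

/-- The split octonions: `L ^ 2 = 1`, with basis `1, I, J, K, KL, JL, IL, L`. -/
abbrev SplitOctonion : Type := Oct 1

namespace SplitOctonion

/-- The unit `I`. -/
def I : SplitOctonion := ⟨⟨0, 1, 0, 0⟩, 0⟩

/-- The unit `J`. -/
def J : SplitOctonion := ⟨⟨0, 0, 1, 0⟩, 0⟩

/-- The unit `K`. -/
def K : SplitOctonion := ⟨⟨0, 0, 0, 1⟩, 0⟩

/-- The unit `L`. -/
def L : SplitOctonion := ⟨0, 1⟩

/-- The idempotents `L₊ = (1 + L) / 2` and `L₋ = (1 - L) / 2`, for the signs `1` and `-1`. -/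
def idem (ε : ℤˣ) : SplitOctonion := (1 / 2 : ℝ) • (1 + ((ε : ℤ) : ℝ) • L)

/-- The sets `{I, J, K} L₊` and `{I, J, K} L₋` of null split octonions. -/
def nullUnits (ε : ℤˣ) : Set SplitOctonion := {I * idem ε, J * idem ε, K * idem ε}

/-- The imaginary split octonions orthogonal to `L`, that is, anticommuting with `L`. -/
def labels : Submodule ℝ SplitOctonion where
  carrier := {Q | star Q = -Q ∧ Q * L = -(L * Q)}
  add_mem' {P Q} hP hQ := by
    refine ⟨?_, ?_⟩
    · rw [star_add, hP.1, hQ.1, neg_add]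
    · rw [add_mul, mul_add, hP.2, hQ.2, neg_add]
  zero_mem' := by simp
  smul_mem' r Q hQ := by
    refine ⟨?_, ?_⟩
    · rw [star_smul, hQ.1, smul_neg, star_trivial]
    · rw [smul_mul_assoc, mul_smul_comm, hQ.2, smul_neg]

theorem mem_labels {Q : SplitOctonion} (h₁ : Q.fst.re = 0) (h₂ : Q.snd.re = 0) :
    Q ∈ labels := by
  constructor <;> apply Oct.ext <;> ext <;> simp [L, h₁, h₂]

theorem mul_idem_mem {Q : SplitOctonion} (ε : ℤˣ) (h₁ : Q.fst.re = 0) (h₂ : Q.snd = 0) :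
    Q * idem ε ∈ labels := by
  apply mem_labels <;> simp [idem, L, h₁, h₂]

theorem nullUnits_subset {ε : ℤˣ} {Q : SplitOctonion} (h : Q ∈ nullUnits ε) : Q ∈ labels := by
  rcases h with rfl | rfl | rfl <;> exact mul_idem_mem ε rfl rfl

end SplitOctonion

/-! ## The Albert algebra -/

/-- The Albert algebra of `3 × 3` Hermitian octonionic matrices. -/
abbrev Albert : Submodule ℝ (Matrix (Fin 3) (Fin 3) Octonion) :=
  selfAdjoint.submodule ℝ (Matrix (Fin 3) (Fin 3) Octonion)

namespace Albert

/-- The identity matrix. -/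
def one : Albert := ⟨1, by
  change star (1 : Matrix (Fin 3) (Fin 3) Octonion) = 1
  simp⟩

/-- The trace, a real number since the diagonal entries of a Hermitian matrix are real. -/
def tr (X : Albert) : ℝ := Oct.re (X : Matrix (Fin 3) (Fin 3) Octonion).trace

/-- The Jordan product `(X Y + Y X) / 2`. -/
def jordan (X Y : Albert) : Albert :=
  ⟨(1 / 2 : ℝ) • ((X : Matrix (Fin 3) (Fin 3) Octonion) * Y.1 + Y.1 * X.1), by
    have hX : star X.1 = X.1 := X.2
    have hY : star Y.1 = Y.1 := Y.2
    change star _ = _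
    rw [star_smul, star_add, star_mul, star_mul, hX, hY, star_trivial, add_comm]⟩

/-- The Freudenthal product. -/
def freudenthal (X Y : Albert) : Albert :=
  jordan X Y - (1 / 2 : ℝ) • (tr X • Y + tr Y • X)
    + ((1 / 2 : ℝ) * (tr X * tr Y - tr (jordan X Y))) • one

/-- The tracefree part `X₀ = X - (tr X / 3) I`. -/
def tracefree (X : Albert) : Albert := X - ((1 / 3 : ℝ) * tr X) • one

theorem trace_eq (X : Albert) :
    (X : Matrix (Fin 3) (Fin 3) Octonion).trace = tr X • (1 : Octonion) := by
  apply Oct.eq_re_smul_one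
  have hX : star X.1 = X.1 := X.2
  rw [← Matrix.trace_conjTranspose, ← Matrix.star_eq_conjTranspose, hX]

theorem trace_tracefree (X : Albert) :
    (tracefree X : Matrix (Fin 3) (Fin 3) Octonion).trace = 0 := by
  have h1 : (one : Matrix (Fin 3) (Fin 3) Octonion).trace = (3 : ℝ) • (1 : Octonion) := by
    simp only [one, Matrix.trace, Matrix.diag, Matrix.one_apply_eq, Fin.sum_univ_three]
    module
  simp only [tracefree, Submodule.coe_sub, Submodule.coe_smul, Matrix.trace_sub,
    Matrix.trace_smul, trace_eq, h1]
  module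

end Albert

/-! ## The Lie algebra `e₈₍₋₂₄₎` -/

/-- The algebra `𝕆' ⊗ 𝕆`; its star operation conjugates both factors. -/
abbrev OctTensor : Type := SplitOctonion ⊗[ℝ] Octonion

/-- The tracefree anti-Hermitian `3 × 3` matrices over `𝕆' ⊗ 𝕆`. -/
abbrev SkewTracefree : Submodule ℝ (Matrix (Fin 3) (Fin 3) OctTensor) :=
  skewAdjoint.submodule ℝ (Matrix (Fin 3) (Fin 3) OctTensor) ⊓
    LinearMap.ker (Matrix.traceLinearMap (Fin 3) ℝ OctTensor)

theorem mem_skewTracefree {A : Matrix (Fin 3) (Fin 3) OctTensor} :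
    A ∈ SkewTracefree ↔ star A = -A ∧ A.trace = 0 := Iff.rfl

/-- The vector space of `e₈`: tracefree anti-Hermitian `3 × 3` matrices over `𝕆' ⊗ 𝕆`, together
with the derivations of `𝕆'` and of `𝕆`. -/
abbrev E8 : Type := SkewTracefree × Oct.der 1 × Oct.der (-1)

namespace E8

/-- The tracefree part `A - (tr A / 3) I` of a matrix over `𝕆' ⊗ 𝕆`. -/
def tracefree (A : Matrix (Fin 3) (Fin 3) OctTensor) : Matrix (Fin 3) (Fin 3) OctTensor :=
  A - Matrix.diagonal fun _ => (1 / 3 : ℝ) • A.trace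

/-- The derivation `d ⊗ 1 + 1 ⊗ d'` of `𝕆' ⊗ 𝕆`. -/
def derTensor (d : Oct.der 1) (d' : Oct.der (-1)) : OctTensor →ₗ[ℝ] OctTensor :=
  LinearMap.rTensor Octonion d.1 + LinearMap.lTensor SplitOctonion d'.1

/-- The entrywise action on matrices of a derivation of `𝕆'` and a derivation of `𝕆`. -/
def act (d : Oct.der 1) (d' : Oct.der (-1)) (A : Matrix (Fin 3) (Fin 3) OctTensor) :
    Matrix (Fin 3) (Fin 3) OctTensor :=
  A.map (derTensor d d')

/-- The bilinear map `(p ⊗ x, q ⊗ y) ↦ Re (x y) D_{p,q}`. -/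
def splitDer : OctTensor →ₗ[ℝ] OctTensor →ₗ[ℝ] Oct.der 1 :=
  (TensorProduct.map₂ (Oct.innerDer (γ := 1)) (Oct.reMul (γ := -1))).compr₂
    (TensorProduct.rid ℝ (Oct.der 1)).toLinearMap

/-- The bilinear map `(p ⊗ x, q ⊗ y) ↦ Re (p q) D_{x,y}`. -/
def octDer : OctTensor →ₗ[ℝ] OctTensor →ₗ[ℝ] Oct.der (-1) :=
  (TensorProduct.map₂ (Oct.reMul (γ := 1)) (Oct.innerDer (γ := -1))).compr₂
    (TensorProduct.lid ℝ (Oct.der (-1))).toLinearMap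

theorem splitDer_tmul (p q : SplitOctonion) (x y : Octonion) :
    splitDer (p ⊗ₜ x) (q ⊗ₜ y) = Oct.re (x * y) • Oct.innerDer p q := by
  simp [splitDer, Oct.reMul]

theorem octDer_tmul (p q : SplitOctonion) (x y : Octonion) :
    octDer (p ⊗ₜ x) (q ⊗ₜ y) = Oct.re (p * q) • Oct.innerDer x y := by
  simp [octDer, Oct.reMul]

theorem tracefree_mem {A : Matrix (Fin 3) (Fin 3) OctTensor} (h : star A = -A) :
    tracefree A ∈ SkewTracefree := by
  rw [mem_skewTracefree]
  have ht : star A.trace = -A.trace := by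
    rw [← Matrix.trace_conjTranspose, ← Matrix.star_eq_conjTranspose, h, Matrix.trace_neg]
  refine ⟨?_, ?_⟩
  · rw [tracefree, star_sub, h, Matrix.star_eq_conjTranspose, Matrix.diagonal_conjTranspose]
    ext i j
    by_cases hij : i = j
    · subst hij
      simp [ht]
      abel
    · simp [hij]
  · simp only [tracefree, Matrix.trace_sub, Matrix.trace_diagonal, Finset.sum_const,
      Finset.card_univ, Fintype.card_fin]
    module

theorem derTensor_star (d : Oct.der 1) (d' : Oct.der (-1)) (t : OctTensor) :
    derTensor d d' (star t) = star (derTensor d d' t) := by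
  induction t using TensorProduct.induction_on with
  | zero => simp
  | tmul p x => simp [derTensor, Oct.der_star d.2, Oct.der_star d'.2]
  | add s t hs ht => rw [star_add, map_add, hs, ht, map_add, star_add]

theorem act_mem (d : Oct.der 1) (d' : Oct.der (-1)) (A : SkewTracefree) :
    act d d' A.1 ∈ SkewTracefree := by
  obtain ⟨A, hA⟩ := A
  rw [mem_skewTracefree] at hA ⊢
  refine ⟨?_, ?_⟩
  · ext i j
    have h : star (A j i) = -A i j := congrFun (congrFun hA.1 i) j
    simp only [act, Matrix.star_apply, Matrix.map_apply, Matrix.neg_apply]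
    rw [← derTensor_star, h, map_neg]
  · have h := hA.2
    simp only [Matrix.trace, Matrix.diag, act, Matrix.map_apply] at h ⊢
    rw [← map_sum, h, map_zero]

theorem star_commutator {A B : Matrix (Fin 3) (Fin 3) OctTensor} (hA : star A = -A)
    (hB : star B = -B) : star (A * B - B * A) = -(A * B - B * A) := by
  have h1 : star (A * B) = star B * star A := star_mul A B
  have h2 : star (B * A) = star A * star B := star_mul B A
  have h3 : -B * -A = B * A := neg_mul_neg B A
  have h4 : -A * -B = A * B := neg_mul_neg A B
  rw [star_sub, h1, h2, hA, hB, h3, h4, neg_sub]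

/-- The bracket of `e₈`. On matrices it is the commutator, with the trace part
`(1/3) ∑ [a_ij, b_ji]` of the commutator replaced by the derivation
`(1/3) ∑ D(a_ij, b_ji)`, where `D(p ⊗ x, q ⊗ y) = Re (x y) D_{p,q} + Re (p q) D_{x,y}`.
Derivations act on matrices entrywise, and on each other by the commutator. -/
instance : Bracket E8 E8 where
  bracket a b :=
    (⟨tracefree (a.1.1 * b.1.1 - b.1.1 * a.1.1), tracefree_mem (star_commutator a.1.2.1 b.1.2.1)⟩
        + ⟨act a.2.1 a.2.2 b.1.1, act_mem _ _ _⟩ - ⟨act b.2.1 b.2.2 a.1.1, act_mem _ _ _⟩,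
      ⟨a.2.1.1 * b.2.1.1 - b.2.1.1 * a.2.1.1, Oct.commutator_mem_der a.2.1.2 b.2.1.2⟩
        + (1 / 3 : ℝ) • ∑ i : Fin 3, ∑ j : Fin 3, splitDer (a.1.1 i j) (b.1.1 j i),
      ⟨a.2.2.1 * b.2.2.1 - b.2.2.1 * a.2.2.1, Oct.commutator_mem_der a.2.2.2 b.2.2.2⟩
        + (1 / 3 : ℝ) • ∑ i : Fin 3, ∑ j : Fin 3, octDer (a.1.1 i j) (b.1.1 j i))

/-- The element of `e₈` given by a tracefree anti-Hermitian matrix. -/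
def ofMatrix (A : Matrix (Fin 3) (Fin 3) OctTensor) (h : A ∈ SkewTracefree) : E8 :=
  (⟨A, h⟩, 0, 0)

/-- The off-diagonal element `X_p`. -/
def X (p : OctTensor) : E8 := ofMatrix !![0, p, 0; -star p, 0, 0; 0, 0, 0] <| by
  rw [mem_skewTracefree]
  refine ⟨?_, by simp [Matrix.trace_fin_three]⟩
  ext i j
  fin_cases i <;> fin_cases j <;> simp

/-- The off-diagonal element `Y_p`. -/
def Y (p : OctTensor) : E8 := ofMatrix !![0, 0, 0; 0, 0, p; 0, -star p, 0] <| by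
  rw [mem_skewTracefree]
  refine ⟨?_, by simp [Matrix.trace_fin_three]⟩
  ext i j
  fin_cases i <;> fin_cases j <;> simp

/-- The off-diagonal element `Z_p`. -/
def Z (p : OctTensor) : E8 := ofMatrix !![0, 0, -star p; 0, 0, 0; p, 0, 0] <| by
  rw [mem_skewTracefree]
  refine ⟨?_, by simp [Matrix.trace_fin_three]⟩
  ext i j
  fin_cases i <;> fin_cases j <;> simp

/-- The nested element `D_{p,q} = [X_p, X_q] / 2`. -/
def nestedD (p q : SplitOctonion) : E8 := (1 / 2 : ℝ) • ⁅X (p ⊗ₜ 1), X (q ⊗ₜ 1)⁆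

/-- The nested element `E_{p,q} = [Y_p, Y_q] / 2`. -/
def nestedE (p q : SplitOctonion) : E8 := (1 / 2 : ℝ) • ⁅Y (p ⊗ₜ 1), Y (q ⊗ₜ 1)⁆

/-- The nested element `F_{p,q} = [Z_p, Z_q] / 2`. -/
def nestedF (p q : SplitOctonion) : E8 := (1 / 2 : ℝ) • ⁅Z (p ⊗ₜ 1), Z (q ⊗ₜ 1)⁆

/-- The nested multiple `(p ∘ q) I` of the identity matrix, for anticommuting `p` and `q`. It is
fixed by `D_{p,q} + E_{p,q} + F_{p,q} = 2 (p ∘ q) I`. -/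
def nestedScalar (p q : SplitOctonion) : E8 :=
  (1 / 2 : ℝ) • (nestedD p q + nestedE p q + nestedF p q)

/-- The element `G_Q = -2 (QL ∘ L) I`. -/
def G (Q : SplitOctonion.labels) : E8 :=
  (-2 : ℝ) • nestedScalar (Q.1 * SplitOctonion.L) SplitOctonion.L

theorem tmul_mem (Q : SplitOctonion.labels) (A : Albert)
    (hA : (A : Matrix (Fin 3) (Fin 3) Octonion).trace = 0) :
    (A : Matrix (Fin 3) (Fin 3) Octonion).map (fun x => Q.1 ⊗ₜ[ℝ] x) ∈ SkewTracefree := by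
  rw [mem_skewTracefree]
  have hQ := Q.2.1
  refine ⟨?_, ?_⟩
  · ext i j
    have h : star (A.1 j i) = A.1 i j := congrFun (congrFun A.2 i) j
    simp only [Matrix.star_apply, Matrix.map_apply, Matrix.neg_apply, TensorProduct.star_tmul]
    rw [h, hQ, TensorProduct.neg_tmul]
  · simp only [Matrix.trace, Matrix.diag, Matrix.map_apply] at hA ⊢
    rw [← TensorProduct.tmul_sum, hA, TensorProduct.tmul_zero]

/-- The labeled Albert algebra element `Q A` in `e₈`: the tracefree part `A₀` gives the matrix
`Q A₀`, and the remaining part `(tr A / 3) Q I` is interpreted with `Q I := -(1/2) G_Q`. -/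
def labeled (Q : SplitOctonion.labels) (A : Albert) : E8 :=
  ofMatrix ((Albert.tracefree A).1.map fun x => Q.1 ⊗ₜ[ℝ] x) (tmul_mem Q (Albert.tracefree A)
      (Albert.trace_tracefree A))
    + ((1 / 3 : ℝ) * Albert.tr A) • ((-(1 / 2) : ℝ) • G Q)

end E8

end

/-! Write `D p q` for the inner derivation. The nested element `Q I` is `(1/2) D (QL) L`
(`E8.nestedScalar_eq`), so `Q X` has matrix part `Q X₀` and split-derivation part `(tr X / 6) D (QL)
L` (`E8.labeled_eq`). The bracket can then be compared with the claim in each of the three summands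
of `e₈`.

Matrices: `Q₁` and `Q₂` anticommute, so the commutator of `Q₁ X₀` and `Q₂ Y₀` is `Q₁Q₂` times the
anticommutator of `X₀` and `Y₀`. The derivation parts act on labels by `D (PL) L Q = -2 PQ`, which
supplies the terms `tr X • Y₀` and `tr Y • X₀` of `Albert.tracefree_freudenthal`.

Derivations of `𝕆'`: the two matrices contribute `tr (X₀ ∘ Y₀) D Q₁ Q₂ / 3`, and the two derivations
contribute their commutator. Both are multiples of `D ((Q₁Q₂)L) L`, by `innerEnd_mul_mul_L` and
`commutator_innerEnd_mul_L`, and the coefficients add up to `tr (X * Y) / 3` by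
`Albert.tr_freudenthal`.

Derivations of `𝕆`: these vanish because `Re (Q₁Q₂) = 0`.

The split-octonion input is that `L` acts on the right by `ε` on the null units of sign `ε` and by
`-ε` on their products. -/

/-! ### Associators and inner derivations of a Cayley-Dickson double. -/

namespace Oct

variable {γ : ℝ}

theorem re_one : re (1 : Oct γ) = 1 := by simp [re_apply]

theorem re_mul_comm (x y : Oct γ) : re (x * y) = re (y * x) := by
  simp [re_apply]
  ring

theorem re_eq_zero_of_star_eq_neg {x : Oct γ} (h : star x = -x) : re x = 0 := by
  have h' := congrArg (fun t => t.fst.re) h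
  simp only [star_fst, neg_fst, Quaternion.re_star, Quaternion.re_neg] at h'
  rw [re_apply]
  linarith

/-- A consequence of the pentagon and product identities once the alternating property has matched
their terms. It is exactly what the cyclic identity for inner derivations needs. -/
theorem associator_commutator (x y z w : Oct γ) :
    associator x y z * w - w * associator x y z =
      associator (x * y) z w + associator (y * z) x w + associator (z * x) y w := by
  have h1 := associator_swap_left x (y * z) w
  have h2 := associator_swap_right x y (z * w)
  have h3 := associator_swap_right (z * x) y w
  have h4 := congrArg (x * ·) (associator_swap_right z y w)
  have h5 := congrArg (x * ·) (associator_swap_left y z w)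
  have h6 := congrArg (w * ·) (associator_swap_right x y z)
  simp only [mul_neg] at h4 h5 h6
  linear_combination (norm := module) associator_pentagon x z w y - associator_pentagon x y z w
    - associator_product x z w y - h1 + h2 - h3 + h4 - h5 - h6

/-- The commutators `[xy, z]`, `[yz, x]`, `[zx, y]` sum to three equal associators, so their action
on `w` is three times the left side of `associator_commutator`. The associator terms of `innerEnd`
subtract three times its right side. -/
theorem innerEnd_cyclic (x y z : Oct γ) :
    innerEnd (x * y) z + innerEnd (y * z) x + innerEnd (z * x) y = 0 := by
  ext1 w
  have h := associator_commutator x y z w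
  have e1 : associator y z x = associator x y z := by
    rw [associator_swap_right y x z, associator_swap_left x y z, neg_neg]
  have e2 : associator z x y = associator x y z := by
    rw [associator_swap_left x z y, associator_swap_right x y z, neg_neg]
  have h1 := congrArg (· * w) e1
  have h2 := congrArg (w * ·) e1
  have h3 := congrArg (· * w) e2
  have h4 := congrArg (w * ·) e2
  simp only [associator, LinearMap.add_apply, LinearMap.zero_apply, innerEnd_apply, sub_mul,
    mul_sub] at h h1 h2 h3 h4 ⊢
  linear_combination (norm := module) (3 : ℝ) • h + h1 - h2 + h3 - h4

theorem innerEnd_swap (x y : Oct γ) : innerEnd y x = -innerEnd x y := by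
  ext1 z
  have h := associator_swap_left x y z
  simp only [associator] at h
  simp only [LinearMap.neg_apply, innerEnd_apply, sub_mul, mul_sub]
  linear_combination (norm := module) (-3 : ℝ) • h

/-- `innerEnd` is built from products alone, so a derivation differentiates it by the Leibniz rule.
-/
theorem commutator_innerEnd {D : Module.End ℝ (Oct γ)} (hD : D ∈ der γ) (x y : Oct γ) :
    D * innerEnd x y - innerEnd x y * D = innerEnd (D x) y + innerEnd x (D y) := by
  have h : ∀ x y, D (x * y) = D x * y + x * D y := hD
  ext1 z
  simp only [LinearMap.sub_apply, LinearMap.add_apply, Module.End.mul_apply, innerEnd_apply,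
    map_sub, map_smul, h, sub_mul, mul_sub, add_mul, mul_add]
  module

theorem innerDer_one_one : innerDer (1 : Oct γ) 1 = 0 := by
  apply Subtype.ext
  ext1 z
  change innerEnd 1 1 z = 0
  simp [innerEnd_apply]

end Oct

/-! ### Null split octonions and their derivations. -/

namespace SplitOctonion

theorem L_mul_L : L * L = 1 := by
  apply Oct.ext <;> ext <;> simp [L]

theorem star_L : star L = -L := by
  apply Oct.ext <;> ext <;> simp [L]

theorem mul_idem_eq (ε : ℤˣ) {q : SplitOctonion} (h : q.snd = 0) :
    q * idem ε = ⟨(1 / 2 : ℝ) • q.fst, ((ε : ℤ) / 2 : ℝ) • q.fst⟩ := by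
  apply Oct.ext <;> ext <;> simp [idem, L, h] <;> ring

/-- One imaginary quaternion `a` describes all three units of a family, which turns the identities
below into quaternion computations for each sign. -/
theorem exists_of_mem_nullUnits {ε : ℤˣ} {Q : SplitOctonion} (h : Q ∈ nullUnits ε) :
    ∃ a : ℍ[ℝ], a.re = 0 ∧ Q = ⟨(1 / 2 : ℝ) • a, ((ε : ℤ) / 2 : ℝ) • a⟩ := by
  rcases h with rfl | rfl | rfl
  · exact ⟨_, rfl, mul_idem_eq ε rfl⟩
  · exact ⟨_, rfl, mul_idem_eq ε rfl⟩
  · exact ⟨_, rfl, mul_idem_eq ε rfl⟩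

variable {ε : ℤˣ} {P Q : SplitOctonion}

theorem mul_mem_labels (hP : P ∈ nullUnits ε) (hQ : Q ∈ nullUnits ε) : P * Q ∈ labels := by
  obtain ⟨a, ha, rfl⟩ := exists_of_mem_nullUnits hP
  obtain ⟨b, hb, rfl⟩ := exists_of_mem_nullUnits hQ
  rcases Int.units_eq_one_or ε with rfl | rfl <;> apply mem_labels <;> simp [ha, hb] <;> ring

theorem mul_comm_of_mem_nullUnits (hP : P ∈ nullUnits ε) (hQ : Q ∈ nullUnits ε) :
    Q * P = -(P * Q) := by
  obtain ⟨a, ha, rfl⟩ := exists_of_mem_nullUnits hP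
  obtain ⟨b, hb, rfl⟩ := exists_of_mem_nullUnits hQ
  rcases Int.units_eq_one_or ε with rfl | rfl <;> apply Oct.ext <;> ext <;>
    simp [ha, hb] <;> ring

theorem mul_L_of_mem_nullUnits (hP : P ∈ nullUnits ε) : P * L = ((ε : ℤ) : ℝ) • P := by
  obtain ⟨a, ha, rfl⟩ := exists_of_mem_nullUnits hP
  rcases Int.units_eq_one_or ε with rfl | rfl <;> apply Oct.ext <;> ext <;>
    simp [L] <;> ring

/-- The sign is opposite to that of `mul_L_of_mem_nullUnits`: products of null units land in the
span of the other family. -/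
theorem mul_mul_L_of_mem_nullUnits (hP : P ∈ nullUnits ε) (hQ : Q ∈ nullUnits ε) :
    P * Q * L = -(((ε : ℤ) : ℝ) • (P * Q)) := by
  obtain ⟨a, ha, rfl⟩ := exists_of_mem_nullUnits hP
  obtain ⟨b, hb, rfl⟩ := exists_of_mem_nullUnits hQ
  rcases Int.units_eq_one_or ε with rfl | rfl <;> apply Oct.ext <;> ext <;>
    simp [ha, hb, L] <;> ring

theorem units_mul_self (ε : ℤˣ) : ((ε : ℤ) : ℝ) * ((ε : ℤ) : ℝ) = 1 := by
  rcases Int.units_eq_one_or ε with rfl | rfl <;> simp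

/-- The constant is `4 - 6`: since `PL = εP`, the commutator term gives `4 PQ`, and the associator
of `P, L, Q` is `2ε PQ`. -/
theorem innerEnd_mul_L_apply (hP : P ∈ nullUnits ε) (hQ : Q ∈ nullUnits ε) :
    Oct.innerEnd (P * L) L Q = (-2 : ℝ) • (P * Q) := by
  obtain ⟨a, ha, rfl⟩ := exists_of_mem_nullUnits hP
  obtain ⟨b, hb, rfl⟩ := exists_of_mem_nullUnits hQ
  rcases Int.units_eq_one_or ε with rfl | rfl <;> apply Oct.ext <;> ext <;>
    simp [ha, hb, Oct.innerEnd_apply, L] <;> ring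

theorem innerEnd_mul_L_apply_L (hP : P ∈ nullUnits ε) :
    Oct.innerEnd (P * L) L L = (4 : ℝ) • (P * L) := by
  obtain ⟨a, ha, rfl⟩ := exists_of_mem_nullUnits hP
  rcases Int.units_eq_one_or ε with rfl | rfl <;> apply Oct.ext <;> ext <;>
    simp [ha, Oct.innerEnd_apply, L] <;> ring

/-- The cyclic identity for `P, Q, L`, with `QL = εQ` and `LP = -εP`, reads `D (PQ) L = 2ε D P Q`;
then `(PQ)L = -ε PQ` and `ε² = 1`. -/
theorem innerEnd_mul_mul_L (hP : P ∈ nullUnits ε) (hQ : Q ∈ nullUnits ε) :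
    Oct.innerEnd (P * Q * L) L = (-2 : ℝ) • Oct.innerEnd P Q := by
  have h := Oct.innerEnd_cyclic P Q L
  have hL : L * P = -(P * L) := by rw [(nullUnits_subset hP).2, neg_neg]
  rw [hL, mul_L_of_mem_nullUnits hP, mul_L_of_mem_nullUnits hQ, ← neg_smul,
    Oct.innerEnd_smul_left, Oct.innerEnd_smul_left, Oct.innerEnd_swap P Q] at h
  rw [mul_mul_L_of_mem_nullUnits hP hQ, ← neg_smul, Oct.innerEnd_smul_left]
  have e := congrArg (· • Oct.innerEnd P Q) (units_mul_self ε)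
  linear_combination (norm := module) (-((ε : ℤ) : ℝ)) • h - (2 : ℝ) • e

/-- The Leibniz rule gives `2 D ((PQ)L) L + 4 D (QL) (PL)`. The last term is `-4 D P Q`, which is
again `2 D ((PQ)L) L`. -/
theorem commutator_innerEnd_mul_L (hP : P ∈ nullUnits ε) (hQ : Q ∈ nullUnits ε) :
    Oct.innerEnd (P * L) L * Oct.innerEnd (Q * L) L
      - Oct.innerEnd (Q * L) L * Oct.innerEnd (P * L) L =
    (4 : ℝ) • Oct.innerEnd (P * Q * L) L := by
  rw [Oct.commutator_innerEnd (Oct.innerEnd_mem_der _ _), innerEnd_mul_L_apply_L hP]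
  have h1 : Oct.innerEnd (P * L) L (Q * L) = (2 : ℝ) • (P * Q * L) := by
    rw [mul_L_of_mem_nullUnits hQ, map_smul, innerEnd_mul_L_apply hP hQ,
      mul_mul_L_of_mem_nullUnits hP hQ]
    module
  rw [h1, mul_L_of_mem_nullUnits hP, mul_L_of_mem_nullUnits hQ]
  simp only [Oct.innerEnd_smul_left, Oct.innerEnd_smul_right, Oct.innerEnd_swap P Q]
  rw [innerEnd_mul_mul_L hP hQ]
  have e := congrArg (· • Oct.innerEnd P Q) (units_mul_self ε)
  linear_combination (norm := module) (-4 : ℝ) • e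

end SplitOctonion

/-! ### Traces and tracefree parts of Jordan and Freudenthal products. -/

namespace Albert

theorem tr_add (X Y : Albert) : tr (X + Y) = tr X + tr Y := by
  simp [tr, Matrix.trace_add]

theorem tr_sub (X Y : Albert) : tr (X - Y) = tr X - tr Y := by
  simp [tr, Matrix.trace_sub]

theorem tr_smul (r : ℝ) (X : Albert) : tr (r • X) = r * tr X := by
  simp [tr, Matrix.trace_smul]

theorem tr_one : tr one = 3 := by
  simp only [tr, one, Matrix.trace_fin_three, Matrix.one_apply_eq, map_add, Oct.re_one]
  norm_num

theorem tracefree_smul (r : ℝ) (X : Albert) : tracefree (r • X) = r • tracefree X := by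
  simp only [tracefree, tr_smul]
  module

/-- The real part of a product is symmetric even though octonions do not commute. -/
theorem tr_jordan (X Y : Albert) : tr (jordan X Y) = Oct.re (X.1 * Y.1).trace := by
  have h : Oct.re (Y.1 * X.1).trace = Oct.re (X.1 * Y.1).trace := by
    simp only [Matrix.trace, Matrix.diag, Matrix.mul_apply, map_sum]
    rw [Finset.sum_comm]
    exact Finset.sum_congr rfl fun _ _ => Finset.sum_congr rfl fun _ _ => Oct.re_mul_comm _ _
  simp only [tr, jordan, Matrix.trace_smul, Matrix.trace_add, map_smul, map_add, h, smul_eq_mul]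
  ring

theorem jordan_tracefree (X Y : Albert) :
    jordan (tracefree X) (tracefree Y) =
      jordan X Y - ((1 / 3 : ℝ) * tr Y) • X - ((1 / 3 : ℝ) * tr X) • Y
        + ((1 / 3 : ℝ) * tr X * ((1 / 3 : ℝ) * tr Y)) • one := by
  apply Subtype.ext
  have h : (one : Matrix (Fin 3) (Fin 3) Octonion) = 1 := rfl
  simp only [jordan, tracefree, Submodule.coe_add, Submodule.coe_sub, Submodule.coe_smul, h,
    sub_mul, mul_sub, smul_mul_assoc, mul_smul_comm, one_mul, mul_one]
  module

theorem tr_jordan_tracefree (X Y : Albert) :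
    tr (jordan (tracefree X) (tracefree Y)) = tr (jordan X Y) - 1 / 3 * tr X * tr Y := by
  rw [jordan_tracefree]
  simp only [tr_add, tr_sub, tr_smul, tr_one]
  ring

theorem tr_freudenthal (X Y : Albert) :
    tr (freudenthal X Y) =
      1 / 3 * tr X * tr Y - 1 / 2 * tr (jordan (tracefree X) (tracefree Y)) := by
  rw [tr_jordan_tracefree]
  simp only [freudenthal, tr_add, tr_sub, tr_smul, tr_one]
  ring

theorem tracefree_freudenthal (X Y : Albert) :
    tracefree (freudenthal X Y) = tracefree (jordan (tracefree X) (tracefree Y))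
      - (1 / 6 : ℝ) • (tr X • tracefree Y + tr Y • tracefree X) := by
  rw [tracefree, tr_freudenthal, tracefree.eq_1 (jordan _ _), tr_jordan_tracefree,
    jordan_tracefree]
  simp only [tracefree, freudenthal]
  module

end Albert

/-! ### Brackets of labeled elements in `e₈`. -/

namespace E8

theorem bracket_ofMatrix {A B : Matrix (Fin 3) (Fin 3) OctTensor} (hA : A ∈ SkewTracefree)
    (hB : B ∈ SkewTracefree) :
    ⁅ofMatrix A hA, ofMatrix B hB⁆ =
      (⟨tracefree (A * B - B * A), tracefree_mem (star_commutator hA.1 hB.1)⟩,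
        (1 / 3 : ℝ) • ∑ i, ∑ j, splitDer (A i j) (B j i),
        (1 / 3 : ℝ) • ∑ i, ∑ j, octDer (A i j) (B j i)) := by
  simp only [ofMatrix, Bracket.bracket]
  refine Prod.ext (Subtype.ext ?_) (Prod.ext (Subtype.ext ?_) (Subtype.ext ?_))
  · ext i j; simp [act, derTensor]
  · simp
  · simp

/-- Each commutator is `2PQ` on two of the three diagonal places, so the sum is a multiple of the
identity and its tracefree part is zero. Each bracket carries `2/3` of the derivation. -/
theorem bracket_X_add_Y_add_Z {P Q : OctTensor} (hP : star P = -P) (hQ : star Q = -Q)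
    (h : Q * P = -(P * Q)) :
    ⁅X P, X Q⁆ + ⁅Y P, Y Q⁆ + ⁅Z P, Z Q⁆ = (0, (2 : ℝ) • splitDer P Q, (2 : ℝ) • octDer P Q) := by
  simp only [X, Y, Z, bracket_ofMatrix, hP, hQ, neg_neg]
  refine Prod.ext (Subtype.ext ?_) (Prod.ext ?_ ?_)
  · ext i j
    simp only [Prod.fst_add, Submodule.coe_add, tracefree, Matrix.trace_fin_three,
      Matrix.add_apply, Matrix.sub_apply, Matrix.mul_apply, Fin.sum_univ_three]
    fin_cases i <;> fin_cases j <;> simp [h] <;> module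
  · simp [Fin.sum_univ_three]
    module
  · simp [Fin.sum_univ_three]
    module

theorem nestedScalar_eq {p q : SplitOctonion} (hp : star p = -p) (hq : star q = -q)
    (h : q * p = -(p * q)) :
    nestedScalar p q = (0, (1 / 2 : ℝ) • Oct.innerDer p q, 0) := by
  have h' := bracket_X_add_Y_add_Z (P := p ⊗ₜ 1) (Q := q ⊗ₜ 1)
    (by rw [TensorProduct.star_tmul, hp, star_one, TensorProduct.neg_tmul])
    (by rw [TensorProduct.star_tmul, hq, star_one, TensorProduct.neg_tmul])
    (by simp only [Algebra.TensorProduct.tmul_mul_tmul, h, TensorProduct.neg_tmul])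
  -- The `𝕆` factors are both `1`, so no derivation of `𝕆` survives.
  rw [splitDer_tmul, octDer_tmul, mul_one, Oct.re_one, one_smul, Oct.innerDer_one_one, smul_zero,
    smul_zero] at h'
  rw [nestedScalar, nestedD, nestedE, nestedF, ← smul_add, ← smul_add, h']
  simp only [Prod.smul_mk, smul_zero, smul_smul]
  norm_num

theorem labeled_eq (Q : SplitOctonion.labels) (A : Albert) :
    labeled Q A =
      (⟨(Albert.tracefree A).1.map fun x => Q.1 ⊗ₜ[ℝ] x,
          tmul_mem Q (Albert.tracefree A) (Albert.trace_tracefree A)⟩,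
        ((1 / 6 : ℝ) * Albert.tr A) • Oct.innerDer (Q.1 * SplitOctonion.L) SplitOctonion.L, 0) := by
  have h1 : star (Q.1 * SplitOctonion.L) = -(Q.1 * SplitOctonion.L) := by
    rw [star_mul, Q.2.1, SplitOctonion.star_L, neg_mul_neg, Q.2.2, neg_neg]
  have h2 : SplitOctonion.L * (Q.1 * SplitOctonion.L)
      = -(Q.1 * SplitOctonion.L * SplitOctonion.L) := by
    rw [Oct.associator_self_right, Q.2.2, mul_neg, ← Oct.associator_self_left,
      SplitOctonion.L_mul_L, one_mul, mul_one]
  rw [labeled, G, nestedScalar_eq h1 SplitOctonion.star_L h2]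
  refine Prod.ext ?_ (Prod.ext ?_ ?_)
  · simp [ofMatrix]
  · simp only [ofMatrix, Prod.snd_add, Prod.fst_add, Prod.smul_snd, Prod.smul_fst]
    module
  · simp [ofMatrix]

theorem commutator_map_tmul {P Q : SplitOctonion} (h : Q * P = -(P * Q))
    (A B : Matrix (Fin 3) (Fin 3) Octonion) :
    A.map (fun x => P ⊗ₜ[ℝ] x) * B.map (fun x => Q ⊗ₜ[ℝ] x)
        - B.map (fun x => Q ⊗ₜ[ℝ] x) * A.map (fun x => P ⊗ₜ[ℝ] x) =
      (A * B + B * A).map (fun x => (P * Q) ⊗ₜ[ℝ] x) := by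
  ext i j
  simp only [Matrix.sub_apply, Matrix.mul_apply, Matrix.map_apply, Matrix.add_apply,
    Algebra.TensorProduct.tmul_mul_tmul, h, TensorProduct.neg_tmul, TensorProduct.tmul_add,
    TensorProduct.tmul_sum, Finset.sum_neg_distrib, sub_neg_eq_add]

/-- The trace of a Hermitian matrix is real, so the two notions of tracefree part agree. -/
theorem tracefree_map_tmul (Q : SplitOctonion) (A : Albert) :
    tracefree (A.1.map fun x => Q ⊗ₜ[ℝ] x) =
      (Albert.tracefree A).1.map fun x => Q ⊗ₜ[ℝ] x := by
  have ht : (A.1.map fun x => Q ⊗ₜ[ℝ] x).trace = Q ⊗ₜ[ℝ] (Albert.tr A • (1 : Octonion)) := by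
    rw [← Albert.trace_eq]
    simp only [Matrix.trace, Matrix.diag, Matrix.map_apply, TensorProduct.tmul_sum]
  have h1 : (Albert.one : Matrix (Fin 3) (Fin 3) Octonion) = 1 := rfl
  ext i j
  rw [tracefree, ht]
  by_cases hij : i = j
  · subst hij
    simp [Albert.tracefree, h1, TensorProduct.tmul_sub, smul_smul]
  · simp [Albert.tracefree, h1, hij]

theorem act_map_tmul (d : Oct.der 1) (Q : SplitOctonion) (A : Matrix (Fin 3) (Fin 3) Octonion) :
    act d 0 (A.map fun x => Q ⊗ₜ[ℝ] x) = A.map fun x => d.1 Q ⊗ₜ[ℝ] x := by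
  ext i j
  simp [act, derTensor]

theorem sum_splitDer_tmul (P Q : SplitOctonion) (A B : Albert) :
    ∑ i, ∑ j, splitDer (P ⊗ₜ A.1 i j) (Q ⊗ₜ B.1 j i) =
      Albert.tr (Albert.jordan A B) • Oct.innerDer P Q := by
  simp only [splitDer_tmul, ← Finset.sum_smul]
  congr 1
  simp only [Albert.tr_jordan, Matrix.trace, Matrix.diag, Matrix.mul_apply, map_sum]

theorem sum_octDer_tmul {P Q : SplitOctonion} (h : Oct.re (P * Q) = 0)
    (A B : Matrix (Fin 3) (Fin 3) Octonion) :
    ∑ i, ∑ j, octDer (P ⊗ₜ A i j) (Q ⊗ₜ B j i) = 0 := by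
  simp only [octDer_tmul, h, zero_smul, Finset.sum_const_zero]

end E8

/-! ### The bracket formula, component by component. -/

theorem lemma1 (ε : ℤˣ) (Q₁ Q₂ : SplitOctonion)
    (h₁ : Q₁ ∈ SplitOctonion.nullUnits ε) (h₂ : Q₂ ∈ SplitOctonion.nullUnits ε) (hne : Q₁ ≠ Q₂)
    (X Y : Albert) :
    ∃ hQ : Q₁ * Q₂ ∈ SplitOctonion.labels,
      ⁅E8.labeled ⟨Q₁, SplitOctonion.nullUnits_subset h₁⟩ X,
          E8.labeled ⟨Q₂, SplitOctonion.nullUnits_subset h₂⟩ Y⁆ =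
        (2 : ℝ) • E8.labeled ⟨Q₁ * Q₂, hQ⟩ (Albert.freudenthal X Y) := by
  have hQ := SplitOctonion.mul_mem_labels h₁ h₂
  have hcomm := SplitOctonion.mul_comm_of_mem_nullUnits h₁ h₂
  refine ⟨hQ, ?_⟩
  simp only [E8.labeled_eq, Bracket.bracket]
  refine Prod.ext (Subtype.ext ?_) (Prod.ext ?_ ?_)
  · have hX : ((((1 / 6 : ℝ) * Albert.tr X) • Oct.innerDer (Q₁ * SplitOctonion.L)
        SplitOctonion.L : Oct.der 1) : Module.End ℝ SplitOctonion) Q₂ =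
          (-(1 / 3 : ℝ) * Albert.tr X) • (Q₁ * Q₂) := by
      change ((1 / 6 : ℝ) * Albert.tr X) • Oct.innerEnd (Q₁ * SplitOctonion.L) SplitOctonion.L Q₂
        = _
      rw [SplitOctonion.innerEnd_mul_L_apply h₁ h₂]
      module
    have hY : ((((1 / 6 : ℝ) * Albert.tr Y) • Oct.innerDer (Q₂ * SplitOctonion.L)
        SplitOctonion.L : Oct.der 1) : Module.End ℝ SplitOctonion) Q₁ =
          ((1 / 3 : ℝ) * Albert.tr Y) • (Q₁ * Q₂) := by
      change ((1 / 6 : ℝ) * Albert.tr Y) • Oct.innerEnd (Q₂ * SplitOctonion.L) SplitOctonion.L Q₁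
        = _
      rw [SplitOctonion.innerEnd_mul_L_apply h₂ h₁, hcomm]
      module
    have hJ : (Albert.tracefree X).1 * (Albert.tracefree Y).1
        + (Albert.tracefree Y).1 * (Albert.tracefree X).1 =
          ((2 : ℝ) • Albert.jordan (Albert.tracefree X) (Albert.tracefree Y)).1 := by
      simp only [Albert.jordan, Submodule.coe_smul]
      module
    simp only [Submodule.coe_add, Submodule.coe_sub, Prod.smul_fst, E8.act_map_tmul, hX, hY, E8.commutator_map_tmul hcomm, hJ, E8.tracefree_map_tmul,
      Albert.tracefree_freudenthal, Albert.tracefree_smul]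
    ext i j
    simp only [Matrix.add_apply, Matrix.sub_apply, Matrix.smul_apply, Matrix.map_apply,
      Submodule.coe_add, Submodule.coe_smul, TensorProduct.tmul_add, TensorProduct.tmul_sub,
      TensorProduct.tmul_smul, ← TensorProduct.smul_tmul']
    module
  · simp only [Prod.smul_snd, Prod.smul_fst, Matrix.map_apply, E8.sum_splitDer_tmul,
      Albert.tr_freudenthal]
    apply Subtype.ext
    have hc := SplitOctonion.commutator_innerEnd_mul_L h₁ h₂
    have hi := SplitOctonion.innerEnd_mul_mul_L h₁ h₂
    have hD : ∀ p q : SplitOctonion,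
      ((Oct.innerDer p q : Oct.der 1) : Module.End ℝ SplitOctonion) = Oct.innerEnd p q :=
        fun _ _ => rfl
    simp only [Submodule.coe_add, Submodule.coe_smul, hD, smul_mul_smul_comm]
    -- Everything becomes a multiple of `D Q₁ Q₂` except the commutator of the two derivations,
    -- which `hc` evaluates; its weight `1/36` is the product of the two factors `1/6` in
    -- `labeled_eq`.
    rw [hi] at hc ⊢
    linear_combination (norm := module) ((1 / 36 : ℝ) * Albert.tr X * Albert.tr Y) • hc
  · simp only [Prod.smul_snd, Matrix.map_apply,
      E8.sum_octDer_tmul (Oct.re_eq_zero_of_star_eq_neg hQ.1)]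
    apply Subtype.ext
    simp
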